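/- For $n\ge 1$ let $f(n)$ be the smallest integer $f$ such that every bounded set in $\mathbb R^n$ with at least two points can be partitioned into at most $f$ sets of smaller diameter. Let $M\subset\mathbb R^{24}$ be the set of unit-length elements of the Leech lattice $\Lambda_{24}$, in its standard coordinates scaled so that the shortest nonzero vectors have length $1$: the points $\frac{1}{4\sqrt2}z$ of $\Lambda_{24}$ come from those $z\in\mathbb Z^{24}$ for which there is an integer $m$ with $z_i\equiv m \pmod 2$ for all $i$, $\sum_i z_i\equiv 4m\pmod 8$, and, for each $k$, the set $\{i: z_i\equiv k \pmod 4\}$ is the support of a word of the extended binary Golay code (the cyclic code of length $23$ with generator polynomial $X^{11}+X^{10}+X^6+X^5+X^4+X^2+1$, extended by a parity bit). For an orthonormal basis $\big((e_i)_{i=1}^{24},(f_i)_{i=1}^{24},(g_{i,j})_{1\le i<j\le 24}\big)$ of $\mathbb R^{324}$ define $\Phi:\mathbb R^{24}\to\mathbb R^{324}$ by $$\Phi(x_1,\dots,x_{24})=\frac{2}{\sqrt5}\sum_{i=1}^{24}x_i^2e_i+\frac1{\sqrt5}\sum_{i=1}^{24}x_if_i+\frac{2\sqrt2}{\sqrt5}\sum_{1\le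 i<j\le 24}x_ix_j\,g_{i,j}.$$ Then there are a set $K\subset M$ with exactly $143136$ elements and indices $1\le k<l\le 24$ such that $|x_k|=|x_l|$ for all $x=(x_1,\dots,x_{24})\in K$. For every choice of the orthonormal basis, $\Phi(K)$ lies in a $322$-dimensional affine subspace of $\mathbb R^{324}$, and (Hinrichs) every subset of $\Phi(M)$ whose diameter is smaller than that of $\Phi(M)$ has at most $350$ elements. Consequently $$f(322)\ \ge\ \Big\lceil \frac{|K|}{350}\Big\rceil=\Big\lceil \frac{143136}{350}\Big\rceil=409 .$$ -/

import Mathlib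

noncomputable section

namespace Borsuk

/-- `A` is a disjoint union of at most `m` sets of diameter smaller than that of `A`.
Parts may be empty, which is how "at most" is expressed; a nonempty part occurs only once. -/
def PartitionsIntoSmaller {n : ℕ} (A : Set (EuclideanSpace ℝ (Fin n))) (m : ℕ) : Prop :=
  ∃ P : Fin m → Set (EuclideanSpace ℝ (Fin n)),
    (⋃ i, P i) = A ∧ Pairwise (fun i j => Disjoint (P i) (P j)) ∧
      ∀ i, Metric.diam (P i) < Metric.diam A

/-- The Borsuk number `f(n)`: the least `m` such that every bounded subset of `ℝⁿ` with at least
two points is a disjoint union of at most `m` sets of smaller diameter. -/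
def borsukNumber (n : ℕ) : ℕ :=
  sInf {m : ℕ | ∀ A : Set (EuclideanSpace ℝ (Fin n)),
    Bornology.IsBounded A → A.Nontrivial → PartitionsIntoSmaller A m}

/-- The `j`-th generator of the extended binary Golay code: the coefficients of
`X ^ j * (X ^ 11 + X ^ 10 + X ^ 6 + X ^ 5 + X ^ 4 + X ^ 2 + 1)` in positions `0, …, 22`, followed
by a parity bit in position `23`. -/
def golayGenerator (j : Fin 12) : Fin 24 → ZMod 2 := fun i =>
  if (i : ℕ) = 23 ∨
      ∃ e ∈ ({0, 2, 4, 5, 6, 10, 11} : Finset ℕ), (i : ℕ) = (j : ℕ) + e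
  then 1 else 0

/-- The extended binary Golay code, a `[24, 12, 8]` linear code. -/
def golayCode : Submodule (ZMod 2) (Fin 24 → ZMod 2) :=
  Submodule.span (ZMod 2) (Set.range golayGenerator)

/-- The integer vectors `z` for which `z / √8` belongs to the Leech lattice in its usual
(unimodular) scale: all coordinates are congruent to some `m` modulo `2`, their sum is congruent
to `4 * m` modulo `8`, and for every `k` the coordinates congruent to `k` modulo `4` occupy the
support of a Golay codeword. -/
def IsLeechVector (z : Fin 24 → ℤ) : Prop :=
  ∃ m : ℤ, (∀ i, z i ≡ m [ZMOD 2]) ∧ (∑ i, z i) ≡ 4 * m [ZMOD 8] ∧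
    ∀ k : ℤ, (fun i => if z i ≡ k [ZMOD 4] then (1 : ZMod 2) else 0) ∈ golayCode

/-- The Leech lattice, scaled so that its shortest nonzero vectors have length `1`. -/
def leechLattice : Set (EuclideanSpace ℝ (Fin 24)) :=
  {x | ∃ z : Fin 24 → ℤ, IsLeechVector z ∧ ∀ i, x i = (z i : ℝ) / (4 * √2)}

/-- The elements of unit length in the (rescaled) Leech lattice. -/
def M : Set (EuclideanSpace ℝ (Fin 24)) := {x | x ∈ leechLattice ∧ ‖x‖ = 1}

/-- Index set of the basis vectors `e i`, `f i` and `g i j` with `i < j`, in this order. -/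
abbrev BasisIndex : Type := Fin 24 ⊕ Fin 24 ⊕ {p : Fin 24 × Fin 24 // p.1 < p.2}

/-- The map `Φ : ℝ²⁴ → ℝ³²⁴` belonging to an orthonormal basis of `ℝ³²⁴`. -/
def Phi (b : OrthonormalBasis BasisIndex ℝ (EuclideanSpace ℝ (Fin 324)))
    (x : EuclideanSpace ℝ (Fin 24)) : EuclideanSpace ℝ (Fin 324) :=
  (2 / √5) • (∑ i, (x i) ^ 2 • b (Sum.inl i)) +
  (1 / √5) • (∑ i, x i • b (Sum.inr (Sum.inl i))) +
  (2 * √2 / √5) • (∑ p : {p : Fin 24 × Fin 24 // p.1 < p.2},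
    (x p.1.1 * x p.1.2) • b (Sum.inr (Sum.inr p)))

/-- Orthonormal bases of `ℝ³²⁴` with this index set exist. -/
theorem nonempty_orthonormalBasis :
    Nonempty (OrthonormalBasis BasisIndex ℝ (EuclideanSpace ℝ (Fin 324))) := by
  have h : Fintype.card (Fin 324) = Fintype.card BasisIndex := by
    have h2 : Fintype.card {p : Fin 24 × Fin 24 // p.1 < p.2} = 276 := by
      rw [Fintype.card_subtype]; decide +kernel
    simp [h2]
  exact ⟨(EuclideanSpace.basisFun (Fin 324) ℝ).reindex (Fintype.equivOfCardEq h)⟩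

end Borsuk

end

/-!
Inner products of distinct points of `M` take only the values `-1`, `-1/2`, `-1/4`, `0`, `1/4`
and `1/2`, and `⟪Φ x, Φ y⟫ = (4 * ⟪x, y⟫ ^ 2 + ⟪x, y⟫) / 5`; among these values it is least, and
equal to `0`, for `-1/4` and `0`. A subset of `Φ(M)` of smaller diameter therefore comes from points
with inner products among `-1`, `-1/2`, `1/4` and `1/2`. Remove one point of each antipodal pair.
The removed points have mutual inner products `±1/2`, since `⟪x, y⟫ = 1/4` would give
`⟪x, -y⟫ = -1/4`, and there are at most `25` of them, because twice their Gram matrix is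
nonsingular modulo `2` when its size is even. For the others a quadratic polynomial in the inner
product gives a matrix that is the identity modulo `2` and factors through the `324` monomials of
degrees one and two.

On points with `|x k| = |x l|` the image under `Φ` satisfies two affine equations, so counting the
minimal vectors with `|z 0| = |z 1|` bounds the Borsuk number in dimension `322`. These vectors have
the shapes `(±4², 0²²)`, `(±2⁸, 0¹⁶)` and `(∓3, ±1²³)`, with supports and signs governed by the
Golay code.
-/

namespace Borsuk

open Finset
open scoped symmDiff

/-- The characteristic vector of a finite set, with entries in `R`. Supports of binary words and
supports of integer vectors are both handled through it. -/
def charVec {ι : Type*} [DecidableEq ι] (R : Type*) [Zero R] [One R] (s : Finset ι) : ι → R :=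
  fun i => if i ∈ s then 1 else 0

section CharVec

variable {ι R : Type*} [DecidableEq ι]

theorem charVec_empty [Zero R] [One R] : charVec R (∅ : Finset ι) = 0 := by
  ext i
  simp [charVec]

theorem charVec_injective [Zero R] [One R] [NeZero (1 : R)] :
    Function.Injective (charVec R : Finset ι → ι → R) := by
  intro s t h
  ext i
  have hi := congrFun h i
  by_cases hs : i ∈ s <;> by_cases ht : i ∈ t <;> simp_all [charVec]

theorem charVec_symmDiff [CommRing R] (s t : Finset ι) :
    charVec R (s ∆ t) = charVec R s + charVec R t - 2 * (charVec R s * charVec R t) := by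
  ext i
  by_cases hs : i ∈ s <;> by_cases ht : i ∈ t <;> norm_num [charVec, mem_symmDiff, hs, ht]

theorem charVec_symmDiff_of_charTwo [CommRing R] [CharP R 2] (s t : Finset ι) :
    charVec R (s ∆ t) = charVec R s + charVec R t := by
  ext i
  simp [charVec_symmDiff, CharTwo.two_eq_zero]

theorem charVec_nonneg (s : Finset ι) : 0 ≤ charVec ℤ s := fun i => by
  by_cases hi : i ∈ s <;> simp [charVec, hi]

theorem charVec_mul_self [NonAssocSemiring R] (s : Finset ι) :
    charVec R s * charVec R s = charVec R s := by
  ext i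
  by_cases hi : i ∈ s <;> simp [charVec, hi]

theorem mul_charVec_injective [NonAssocSemiring R] [IsCancelMulZero R] [NeZero (1 : R)]
    {c : ι → R} (hc : ∀ i, c i ≠ 0) :
    Function.Injective fun s : Finset ι => c * charVec R s := fun _ _ h =>
  charVec_injective <| funext fun i => mul_left_cancel₀ (hc i) (congrFun h i)

theorem sum_charVec [Fintype ι] [NonAssocSemiring R] (s : Finset ι) :
    ∑ i, charVec R s i = #s := by
  simp [charVec]

end CharVec

section BinaryWords

variable {n : ℕ}

/-- The positions of the bits set in `w`. Bit vectors are the form in which the kernel can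
enumerate a binary code quickly. -/
def bitSupport (w : BitVec n) : Finset (Fin n) := {i | w[i]}

/-- The words spanned over `𝔽₂` by a list of generators, one for each choice of coefficients. -/
def xorSpan : List (BitVec n) → List (BitVec n)
  | [] => [0]
  | g :: gs => xorSpan gs ++ (xorSpan gs).map (g ^^^ ·)

/-- Linear independence over `𝔽₂` of a list of words, as a Boolean test: no word is spanned by the
words after it. -/
def xorIndependent : List (BitVec n) → Bool
  | [] => true
  | g :: gs => !(xorSpan gs).contains g && xorIndependent gs

theorem mem_bitSupport {w : BitVec n} {i : Fin n} : i ∈ bitSupport w ↔ w[i] = true := by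
  rw [bitSupport, mem_filter_univ]

theorem bitSupport_injective : Function.Injective (bitSupport : BitVec n → Finset (Fin n)) := by
  intro v w h
  ext i hi
  have := Finset.ext_iff.1 h ⟨i, hi⟩
  simpa [bitSupport, ← Bool.eq_iff_iff] using this

theorem bitSupport_zero : bitSupport (0 : BitVec n) = ∅ := by
  simp [bitSupport]

theorem bitSupport_xor (v w : BitVec n) : bitSupport (v ^^^ w) = bitSupport v ∆ bitSupport w := by
  ext i
  cases hv : v[(i : ℕ)] <;> cases hw : w[(i : ℕ)] <;> simp [bitSupport, mem_symmDiff, hv, hw]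

theorem cpopNatRec_eq_sum (w : BitVec n) (k acc : ℕ) :
    w.cpopNatRec k acc = acc + ∑ i ∈ range k, (w.getLsbD i).toNat := by
  induction k generalizing acc with
  | zero => rfl
  | succ k ih => rw [BitVec.cpopNatRec_succ, ih, sum_range_succ]; ring

theorem card_bitSupport (w : BitVec n) : #(bitSupport w) = w.cpopNatRec n 0 := by
  rw [cpopNatRec_eq_sum, zero_add, ← Fin.sum_univ_eq_sum_range (fun i => (w.getLsbD i).toNat),
    bitSupport, card_filter]
  exact sum_congr rfl fun i _ => by simp [BitVec.getLsbD_eq_getElem, Bool.toNat, Bool.cond_eq_ite]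

theorem length_xorSpan (gs : List (BitVec n)) : (xorSpan gs).length = 2 ^ gs.length := by
  induction gs with
  | nil => rfl
  | cons g gs ih => simp [xorSpan, ih, pow_succ, mul_two]

theorem mem_span_bitSupport_iff {gs : List (BitVec n)} {c : Fin n → ZMod 2} :
    c ∈ Submodule.span (ZMod 2) ((fun g => charVec (ZMod 2) (bitSupport g)) '' {g | g ∈ gs}) ↔
      ∃ w ∈ xorSpan gs, charVec (ZMod 2) (bitSupport w) = c := by
  induction gs generalizing c with
  | nil =>
    simp only [xorSpan, List.not_mem_nil, Set.ofPred_false, Set.image_empty,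
      Submodule.span_empty, Submodule.mem_bot, List.mem_singleton, exists_eq_left,
      bitSupport_zero, charVec_empty, eq_comm]
  | cons g gs ih =>
    have hcons : {v | v ∈ g :: gs} = insert g {v | v ∈ gs} := by ext; simp
    simp only [hcons, Set.image_insert_eq, Submodule.mem_span_insert, ih, xorSpan,
      List.mem_append, List.mem_map]
    constructor
    · rintro ⟨a, _, ⟨w, hw, rfl⟩, rfl⟩
      obtain rfl | rfl : a = 0 ∨ a = 1 := by decide +revert
      · exact ⟨w, Or.inl hw, by simp⟩
      · exact ⟨g ^^^ w, Or.inr ⟨w, hw, rfl⟩, by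
          rw [bitSupport_xor, charVec_symmDiff_of_charTwo, one_smul]⟩
    · rintro ⟨_, hw | ⟨w, hw, rfl⟩, rfl⟩
      · exact ⟨0, _, ⟨_, hw, rfl⟩, by simp⟩
      · exact ⟨1, _, ⟨w, hw, rfl⟩, by
          rw [bitSupport_xor, charVec_symmDiff_of_charTwo, one_smul]⟩

theorem xor_mem_xorSpan {gs : List (BitVec n)} {v w : BitVec n} (hv : v ∈ xorSpan gs)
    (hw : w ∈ xorSpan gs) : v ^^^ w ∈ xorSpan gs := by
  obtain ⟨u, hu, huvw⟩ := mem_span_bitSupport_iff.1 <| add_mem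
    (mem_span_bitSupport_iff.2 ⟨v, hv, rfl⟩) (mem_span_bitSupport_iff.2 ⟨w, hw, rfl⟩)
  rw [← charVec_symmDiff_of_charTwo, ← bitSupport_xor] at huvw
  rwa [← bitSupport_injective (charVec_injective huvw)]

theorem nodup_xorSpan {gs : List (BitVec n)} (h : xorIndependent gs) : (xorSpan gs).Nodup := by
  induction gs with
  | nil => exact List.nodup_singleton 0
  | cons g gs ih =>
    simp only [xorIndependent, Bool.and_eq_true, Bool.not_eq_true', List.contains_eq_mem,
      decide_eq_false_iff_not] at h
    have hinj : Function.Injective (g ^^^ ·) := fun v w hvw => (BitVec.xor_right_inj g).1 hvw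
    refine List.nodup_append'.2 ⟨ih h.2, (ih h.2).map hinj, fun v hv hgv => h.1 ?_⟩
    obtain ⟨w, hw, rfl⟩ := List.mem_map.1 hgv
    simpa [BitVec.xor_assoc] using xor_mem_xorSpan hv hw

end BinaryWords

section GolayCode

/-- The generators of the Golay code as bit vectors: `3189` has the bits
`0, 2, 4, 5, 6, 10, 11`, and bit `23` is the parity bit. -/
def golayMask (j : Fin 12) : BitVec 24 := BitVec.ofNat 24 (3189 <<< (j : ℕ) + 2 ^ 23)

/-- The words of the extended binary Golay code, listed for evaluation in the kernel. -/
def golayWords : List (BitVec 24) := xorSpan (List.ofFn golayMask)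

/-- The supports of the words of the extended binary Golay code. -/
noncomputable def golaySets : Finset (Finset (Fin 24)) := by
  classical exact {s | charVec (ZMod 2) s ∈ golayCode}

theorem mem_golaySets {s : Finset (Fin 24)} :
    s ∈ golaySets ↔ charVec (ZMod 2) s ∈ golayCode := by
  simp [golaySets]

theorem charVec_bitSupport_golayMask (j : Fin 12) :
    charVec (ZMod 2) (bitSupport (golayMask j)) = golayGenerator j := by
  have h : ∀ (j : Fin 12) (i : Fin 24), (golayMask j)[i] = true ↔ (i : ℕ) = 23 ∨
      ∃ e ∈ ({0, 2, 4, 5, 6, 10, 11} : Finset ℕ), (i : ℕ) = (j : ℕ) + e := by decide +kernel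
  ext i
  simp only [charVec, golayGenerator, mem_bitSupport, h]

theorem mem_golayCode_iff {c : Fin 24 → ZMod 2} :
    c ∈ golayCode ↔ ∃ w ∈ golayWords, charVec (ZMod 2) (bitSupport w) = c := by
  have hrange : Set.range golayGenerator =
      (fun g => charVec (ZMod 2) (bitSupport g)) '' {g | g ∈ List.ofFn golayMask} := by
    ext c
    simp only [Set.mem_range, Set.mem_image, Set.mem_ofPred_eq, List.mem_ofFn,
      exists_exists_eq_and, charVec_bitSupport_golayMask]
  rw [golayCode, hrange, mem_span_bitSupport_iff, golayWords]

theorem golaySets_eq_image : golaySets = golayWords.toFinset.image bitSupport := by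
  ext s
  simp only [mem_golaySets, mem_golayCode_iff, mem_image, List.mem_toFinset,
    charVec_injective.eq_iff]

theorem nodup_golayWords : golayWords.Nodup := nodup_xorSpan (by decide +kernel)

theorem card_filter_golaySets {p : Finset (Fin 24) → Prop} [DecidablePred p]
    {q : BitVec 24 → Bool} (h : ∀ w, p (bitSupport w) ↔ q w) :
    #{s ∈ golaySets | p s} = (golayWords.filter q).length := by
  simp only [golaySets_eq_image, filter_image, h]
  rw [card_image_of_injective _ bitSupport_injective, ← List.toFinset_filter,
    List.toFinset_card_of_nodup (nodup_golayWords.filter q)]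

theorem card_golaySets : #golaySets = 4096 := by
  rw [golaySets_eq_image, card_image_of_injective _ bitSupport_injective,
    List.toFinset_card_of_nodup nodup_golayWords, golayWords, length_xorSpan]
  rfl

theorem card_mem_of_mem_golaySets {s : Finset (Fin 24)} (hs : s ∈ golaySets) :
    #s ∈ ({0, 8, 12, 16, 24} : Finset ℕ) := by
  have hweights : golayWords.all fun w => [0, 8, 12, 16, 24].contains (w.cpopNatRec 24 0) := by
    decide +kernel
  rw [golaySets_eq_image] at hs
  obtain ⟨w, hw, rfl⟩ := mem_image.1 hs
  simpa [card_bitSupport] using List.all_eq_true.1 hweights w (List.mem_toFinset.1 hw)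

theorem card_filter_octads_balanced :
    #{s ∈ golaySets | #s = 8 ∧ (0 ∈ s ↔ 1 ∈ s)} = 407 := by
  rw [card_filter_golaySets (q := fun w => w.cpopNatRec 24 0 == 8 && w[0] == w[1]) fun w => ?_]
  · decide +kernel
  · rw [card_bitSupport, mem_bitSupport, mem_bitSupport, Bool.and_eq_true, beq_iff_eq, beq_iff_eq,
      Bool.eq_iff_iff (a := w[0])]
    rfl

theorem empty_mem_golaySets : ∅ ∈ golaySets := by
  simp [mem_golaySets, charVec_empty]

theorem symmDiff_mem_golaySets {s t : Finset (Fin 24)} (hs : s ∈ golaySets)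
    (ht : t ∈ golaySets) : s ∆ t ∈ golaySets := by
  rw [mem_golaySets, charVec_symmDiff_of_charTwo]
  exact add_mem (mem_golaySets.1 hs) (mem_golaySets.1 ht)

theorem compl_mem_golaySets {s : Finset (Fin 24)} (hs : s ∈ golaySets) : sᶜ ∈ golaySets := by
  have huniv : univ ∈ golaySets := by
    rw [golaySets_eq_image, mem_image]
    exact ⟨BitVec.allOnes 24, List.mem_toFinset.2 (by decide +kernel), by decide⟩
  rw [← hnot_eq_compl, ← top_symmDiff]
  exact symmDiff_mem_golaySets huniv hs

end GolayCode

section LeechVectors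

variable {z z' : Fin 24 → ℤ}

theorem ite_mem_golayCode_iff {p : Fin 24 → Prop} [DecidablePred p] :
    (fun i => if p i then (1 : ZMod 2) else 0) ∈ golayCode ↔
      ({i | p i} : Finset (Fin 24)) ∈ golaySets := by
  rw [mem_golaySets]
  unfold charVec
  simp only [mem_filter_univ]

theorem isLeechVector_iff : IsLeechVector z ↔ ∃ m : ℤ, ∃ s ∈ golaySets,
    (∀ i, z i ≡ m + 2 * charVec ℤ s i [ZMOD 4]) ∧ ∑ i, z i ≡ 4 * m [ZMOD 8] := by
  constructor
  · rintro ⟨m, hparity, hsum, hmod⟩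
    refine ⟨m, _, ite_mem_golayCode_iff.1 (hmod (m + 2)), fun i => ?_, hsum⟩
    have := hparity i
    simp only [charVec, mem_filter_univ]
    simp only [Int.ModEq] at *
    split_ifs <;> omega
  · rintro ⟨m, s, hs, hz, hsum⟩
    have hz' : ∀ i, i ∈ s ∧ z i ≡ m + 2 [ZMOD 4] ∨ i ∉ s ∧ z i ≡ m [ZMOD 4] := fun i => by
      have := hz i
      by_cases hi : i ∈ s <;> simp_all [charVec]
    refine ⟨m, fun i => ?_, hsum, fun k => ite_mem_golayCode_iff.2 ?_⟩
    · have := hz' i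
      simp only [Int.ModEq] at *
      omega
    obtain h | h | h : k ≡ m [ZMOD 4] ∨ k ≡ m + 2 [ZMOD 4] ∨ k ≡ m + 1 [ZMOD 2] := by
      simp only [Int.ModEq]
      omega
    · convert compl_mem_golaySets hs
      ext i
      have := hz' i
      grind [mem_filter_univ, mem_compl, Int.ModEq]
    · convert hs
      ext i
      have := hz' i
      grind [mem_filter_univ, Int.ModEq]
    · convert empty_mem_golaySets
      ext i
      have := hz' i
      grind [mem_filter_univ, Int.ModEq]

theorem IsLeechVector.add (hz : IsLeechVector z) (hz' : IsLeechVector z') :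
    IsLeechVector (z + z') := by
  obtain ⟨m, s, hs, hmod, hsum⟩ := isLeechVector_iff.1 hz
  obtain ⟨m', s', hs', hmod', hsum'⟩ := isLeechVector_iff.1 hz'
  refine isLeechVector_iff.2 ⟨m + m', s ∆ s', symmDiff_mem_golaySets hs hs', fun i => ?_, ?_⟩
  · refine ((hmod i).add (hmod' i)).trans <|
      Int.modEq_iff_dvd.2 ⟨-charVec ℤ s i * charVec ℤ s' i, ?_⟩
    simp only [charVec_symmDiff, Pi.sub_apply, Pi.add_apply, Pi.mul_apply, Pi.ofNat_apply]
    ring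
  · simp only [Pi.add_apply, sum_add_distrib, mul_add]
    exact hsum.add hsum'

theorem IsLeechVector.neg (hz : IsLeechVector z) : IsLeechVector (-z) := by
  obtain ⟨m, s, hs, hmod, hsum⟩ := isLeechVector_iff.1 hz
  refine isLeechVector_iff.2 ⟨-m, s, hs, fun i => ?_, ?_⟩
  · exact (hmod i).neg.trans (Int.modEq_iff_dvd.2 ⟨charVec ℤ s i, by ring⟩)
  · simpa only [Pi.neg_apply, sum_neg_distrib, mul_neg] using hsum.neg

theorem IsLeechVector.sixteen_dvd_dotProduct_self (hz : IsLeechVector z) : 16 ∣ z ⬝ᵥ z := by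
  obtain ⟨m, s, hs, hmod, hsum⟩ := isLeechVector_iff.1 hz
  have hsq (i) : 16 ∣ z i * z i - (2 * m * z i - m ^ 2 + 4 * charVec ℤ s i) := by
    obtain ⟨y, hy⟩ := (hmod i).symm.dvd
    have hc : charVec ℤ s i ^ 2 = charVec ℤ s i := by by_cases hi : i ∈ s <;> simp [charVec, hi]
    exact ⟨charVec ℤ s i * y + y ^ 2, by
      linear_combination (z i - m + 2 * charVec ℤ s i + 4 * y) * hy + 4 * hc⟩
  have hcard : (4 : ℤ) ∣ #s := by
    have := card_mem_of_mem_golaySets hs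
    simp only [mem_insert, mem_singleton] at this
    omega
  obtain ⟨a, ha⟩ := dvd_sum fun i (_ : i ∈ univ) => hsq i
  obtain ⟨b, hb⟩ := hsum.dvd
  obtain ⟨c, hc⟩ := hcard
  simp only [sum_sub_distrib, sum_add_distrib, ← mul_sum, sum_charVec, sum_const, card_univ,
    Fintype.card_fin, nsmul_eq_mul] at ha
  exact ⟨a - m * b + c - m ^ 2, by
    rw [dotProduct]
    linear_combination ha - 2 * m * hb + 4 * hc⟩

theorem mul_card_le_dotProduct_self {ι R : Type*} [Fintype ι] [CommRing R] [LinearOrder R]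
    [IsStrictOrderedRing R] {v : ι → R} {s : Finset ι} {c : R} (h : ∀ i ∈ s, c ≤ v i * v i) :
    c * #s ≤ v ⬝ᵥ v := by
  calc c * #s = ∑ _i ∈ s, c := by rw [sum_const, nsmul_eq_mul, mul_comm]
    _ ≤ ∑ i ∈ s, v i * v i := sum_le_sum h
    _ ≤ v ⬝ᵥ v := sum_le_univ_sum_of_nonneg fun i => mul_self_nonneg (v i)

theorem IsLeechVector.four_dvd_of_dotProduct_self_lt (hz : IsLeechVector z) (hlt : z ⬝ᵥ z < 24)
    (i : Fin 24) : 4 ∣ z i := by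
  obtain ⟨m, hparity, -, hmod⟩ := hz
  have hmeven : Even m := by
    by_contra hodd
    have hle : 1 * (#(univ : Finset (Fin 24)) : ℤ) ≤ z ⬝ᵥ z :=
      mul_card_le_dotProduct_self fun i _ => by
        have := hparity i
        rw [Int.even_iff] at hodd
        have hi : z i ≠ 0 := by simp only [Int.ModEq] at this; omega
        exact Int.add_one_le_iff.2 (mul_self_pos.2 hi)
    simp only [card_univ, Fintype.card_fin] at hle
    omega
  have hempty : #{i | z i ≡ 2 [ZMOD 4]} = 0 := by
    have hcard := card_mem_of_mem_golaySets (ite_mem_golayCode_iff.1 (hmod 2))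
    have hle : 4 * (#{i | z i ≡ 2 [ZMOD 4]} : ℤ) ≤ z ⬝ᵥ z :=
      mul_card_le_dotProduct_self fun i hi => by
        obtain ⟨a, ha⟩ := ((mem_filter_univ i).1 hi).symm.dvd
        have : 0 ≤ a * (a + 1) := by
          obtain ha | ha := le_or_gt 0 a
          · positivity
          · exact mul_nonneg_of_nonpos_of_nonpos ha.le ha
        rw [show z i = 4 * a + 2 by omega]
        linarith
    simp only [mem_insert, mem_singleton] at hcard
    omega
  have hi : ¬ z i ≡ 2 [ZMOD 4] := fun h =>
    notMem_empty i (card_eq_zero.1 hempty ▸ (mem_filter_univ i).2 h)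
  have := hparity i
  rw [Int.even_iff] at hmeven
  simp only [Int.ModEq] at *
  omega

theorem IsLeechVector.dotProduct_self_ne_sixteen (hz : IsLeechVector z) : z ⬝ᵥ z ≠ 16 := by
  intro h16
  choose v hv using hz.four_dvd_of_dotProduct_self_lt (by omega)
  obtain rfl : z = 4 * v := funext hv
  have hvv : v ⬝ᵥ v = 1 := by
    have : (4 * v) ⬝ᵥ (4 * v) = 16 * (v ⬝ᵥ v) := by
      simp only [dotProduct, mul_sum, Pi.mul_apply, Pi.ofNat_apply]
      exact sum_congr rfl fun i _ => by ring
    omega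
  have hvsum : 2 ∣ v ⬝ᵥ v - ∑ i, v i := by
    rw [dotProduct, ← sum_sub_distrib]
    refine dvd_sum fun i _ => ?_
    rw [← mul_sub_one]
    exact (Int.even_mul_pred_self (v i)).two_dvd
  obtain ⟨m, hparity, hsum, -⟩ := hz
  have hmeven := hparity 0
  simp only [Pi.mul_apply, Pi.ofNat_apply, ← mul_sum, Int.ModEq] at hsum hmeven
  omega

theorem IsLeechVector.dotProduct_mem (hz : IsLeechVector z) (hz' : IsLeechVector z')
    (h : z ⬝ᵥ z = 32) (h' : z' ⬝ᵥ z' = 32) :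
    z ⬝ᵥ z' ∈ ({-32, -16, -8, 0, 8, 16, 32} : Finset ℤ) := by
  have hadd : (z + z') ⬝ᵥ (z + z') = 64 + 2 * (z ⬝ᵥ z') := by
    simp only [add_dotProduct, dotProduct_add, h, h', dotProduct_comm z' z]
    ring
  have hsub : (z + -z') ⬝ᵥ (z + -z') = 64 - 2 * (z ⬝ᵥ z') := by
    simp only [add_dotProduct, dotProduct_add, dotProduct_neg, neg_dotProduct, h, h',
      dotProduct_comm z' z]
    ring
  have hdvd := (hz.add hz').sixteen_dvd_dotProduct_self
  have hne := (hz.add hz').dotProduct_self_ne_sixteen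
  have hne' := (hz.add hz'.neg).dotProduct_self_ne_sixteen
  have hnonneg (v : Fin 24 → ℤ) : 0 ≤ v ⬝ᵥ v := sum_nonneg fun i _ => mul_self_nonneg (v i)
  have hpos := hnonneg (z + z')
  have hpos' := hnonneg (z + -z')
  rw [hadd] at hdvd hne hpos
  rw [hsub] at hne' hpos'
  simp only [mem_insert, mem_singleton]
  omega

/-- The point of the rescaled Leech lattice with integer coordinates `z`. -/
noncomputable def leechPoint (z : Fin 24 → ℤ) : EuclideanSpace ℝ (Fin 24) :=
  WithLp.toLp 2 fun i => (z i : ℝ) / (4 * √2)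

theorem inner_leechPoint (z z' : Fin 24 → ℤ) :
    inner ℝ (leechPoint z) (leechPoint z') = ((z ⬝ᵥ z' : ℤ) : ℝ) / 32 := by
  have h32 : (4 * √2) * (4 * √2) = (32 : ℝ) := by
    rw [mul_mul_mul_comm, Real.mul_self_sqrt zero_le_two]
    norm_num
  simp only [leechPoint, PiLp.inner_apply, dotProduct, Int.cast_sum, sum_div, Int.cast_mul,
    RCLike.inner_apply, conj_trivial, div_mul_div_comm, h32, mul_comm]

theorem leechPoint_injective : Function.Injective leechPoint := by
  intro z z' h
  ext i
  have hi : (z i : ℝ) / (4 * √2) = z' i / (4 * √2) := congrArg (fun x => x.ofLp i) h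
  exact_mod_cast (div_left_inj' (by positivity)).1 hi

theorem norm_leechPoint_eq_one_iff : ‖leechPoint z‖ = 1 ↔ z ⬝ᵥ z = 32 := by
  rw [← pow_eq_one_iff_of_nonneg (norm_nonneg _) two_ne_zero, ← real_inner_self_eq_norm_sq,
    inner_leechPoint, div_eq_one_iff_eq (by norm_num)]
  norm_cast

theorem leechPoint_mem_M (hz : IsLeechVector z) (h : z ⬝ᵥ z = 32) : leechPoint z ∈ M :=
  ⟨⟨z, hz, fun _ => rfl⟩, norm_leechPoint_eq_one_iff.2 h⟩

theorem exists_eq_leechPoint {x : EuclideanSpace ℝ (Fin 24)} (hx : x ∈ M) :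
    ∃ z, IsLeechVector z ∧ z ⬝ᵥ z = 32 ∧ x = leechPoint z := by
  obtain ⟨⟨z, hz, hxz⟩, hnorm⟩ := hx
  obtain rfl : x = leechPoint z := PiLp.ext hxz
  exact ⟨z, hz, norm_leechPoint_eq_one_iff.1 hnorm, rfl⟩

theorem inner_mem_of_mem_M {x y : EuclideanSpace ℝ (Fin 24)} (hx : x ∈ M) (hy : y ∈ M) :
    inner ℝ x y ∈ ({-1, -1 / 2, -1 / 4, 0, 1 / 4, 1 / 2, 1} : Set ℝ) := by
  obtain ⟨z, hz, hzz, rfl⟩ := exists_eq_leechPoint hx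
  obtain ⟨z', hz', hzz', rfl⟩ := exists_eq_leechPoint hy
  have hmem := hz.dotProduct_mem hz' hzz hzz'
  rw [inner_leechPoint]
  simp only [mem_insert, mem_singleton] at hmem
  simp only [Set.mem_insert_iff, Set.mem_singleton_iff]
  rcases hmem with h | h | h | h | h | h | h <;> rw [h] <;> norm_num

end LeechVectors

theorem two_mul_card_powerset_filter_even {α : Type*} {t : Finset α} (ht : t.Nonempty) :
    2 * #{s ∈ t.powerset | Even #s} = 2 ^ #t := by
  have hsum : #{s ∈ t.powerset | Even #s} = #{s ∈ t.powerset | ¬ Even #s} := by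
    have h := sum_powerset_neg_one_pow_card_of_nonempty ht
    rw [← sum_filter_add_sum_filter_not _ (fun s => Even #s)] at h
    rw [sum_congr rfl fun s hs => (mem_filter.1 hs).2.neg_one_pow, sum_const,
      sum_congr (s₁ := {s ∈ t.powerset | ¬ Even #s}) rfl fun s hs =>
        (Nat.not_even_iff_odd.1 (mem_filter.1 hs).2).neg_one_pow, sum_const] at h
    simp only [nsmul_eq_mul, mul_one, mul_neg] at h
    omega
  rw [two_mul, ← card_powerset, ← card_filter_add_card_filter_not (s := t.powerset)
    (fun s => Even #s), ← hsum]

section SignedVectors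

variable {ι τ : Type*} [DecidableEq ι]

/-- The vector `a` with the signs of its entries in `s` reversed. Minimal vectors of the Leech
lattice are described by their absolute values `a` together with a sign set `s`. -/
def signed (s : Finset ι) (a : ι → ℤ) : ι → ℤ := (1 - 2 * charVec ℤ s) * a

theorem signed_apply (s : Finset ι) (a : ι → ℤ) (i : ι) :
    signed s a i = if i ∈ s then -a i else a i := by
  by_cases hi : i ∈ s <;> simp [signed, charVec, hi]

theorem abs_signed {s : Finset ι} {a : ι → ℤ} (ha : 0 ≤ a) (i : ι) : |signed s a i| = a i := by
  rw [signed_apply]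
  split_ifs <;> simp [abs_of_nonneg (ha i)]

theorem signed_dotProduct_signed [Fintype ι] (s : Finset ι) (a : ι → ℤ) :
    signed s a ⬝ᵥ signed s a = a ⬝ᵥ a :=
  sum_congr rfl fun i _ => by rw [signed_apply]; split_ifs <;> ring

theorem signed_lt_zero_iff {s : Finset ι} {a : ι → ℤ} (ha : 0 ≤ a) (hs : ∀ i ∈ s, a i ≠ 0)
    (i : ι) : signed s a i < 0 ↔ i ∈ s := by
  have ha' : 0 ≤ a i := ha i
  have := hs i
  rw [signed_apply]
  grind

theorem charVec_dotProduct_self [Fintype ι] (s : Finset ι) :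
    charVec ℤ s ⬝ᵥ charVec ℤ s = #s := by
  rw [← sum_charVec, dotProduct]
  exact sum_congr rfl fun i _ => congrFun (charVec_mul_self s) i

theorem signed_symmDiff (s t : Finset ι) (a : ι → ℤ) :
    signed (s ∆ t) a = signed s (signed t a) := by
  simp only [signed, charVec_symmDiff]
  ring

variable [Fintype ι]

theorem sum_signed (s : Finset ι) (a : ι → ℤ) :
    ∑ i, signed s a i = ∑ i, a i - 2 * ∑ i, charVec ℤ s i * a i := by
  simp only [signed, Pi.mul_apply, Pi.sub_apply, Pi.ofNat_apply, sub_mul, one_mul,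
    sum_sub_distrib, mul_assoc, mul_sum]

/-- The vectors with absolute values `a t`, for `t ∈ T`, and sign sets in `σ t`. -/
@[irreducible] def signedFamily (T : Finset τ) (a : τ → ι → ℤ) (σ : τ → Finset (Finset ι)) :
    Finset (ι → ℤ) :=
  (T.sigma σ).image fun q => signed q.2 (a q.1)

theorem mem_signedFamily {T : Finset τ} {a : τ → ι → ℤ} {σ : τ → Finset (Finset ι)} {z : ι → ℤ} :
    z ∈ signedFamily T a σ ↔ ∃ t ∈ T, ∃ s ∈ σ t, signed s (a t) = z := by
  simp [signedFamily, and_assoc]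

theorem card_signedFamily {T : Finset τ} {a : τ → ι → ℤ} {σ : τ → Finset (Finset ι)}
    (hinj : Function.Injective a) (ha : ∀ t, 0 ≤ a t)
    (hσ : ∀ t ∈ T, ∀ s ∈ σ t, ∀ i ∈ s, a t i ≠ 0) :
    #(signedFamily T a σ) = ∑ t ∈ T, #(σ t) := by
  rw [signedFamily, card_image_of_injOn, card_sigma]
  rintro ⟨t, s⟩ hts ⟨t', s'⟩ hts' h
  simp only [coe_sigma, Set.mem_sigma_iff, mem_coe] at hts hts'
  obtain rfl : t = t' := hinj <| funext fun i => by
    rw [← abs_signed (s := s) (ha t), ← abs_signed (s := s') (ha t')]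
    exact congrArg abs (congrFun h i)
  obtain rfl : s = s' := Finset.ext fun i => by
    rw [← signed_lt_zero_iff (ha t) (hσ t hts.1 s hts.2),
      ← signed_lt_zero_iff (ha t) (hσ t hts'.1 s' hts'.2)]
    exact iff_of_eq (congrArg (· < 0) (congrFun h i))
  rfl

end SignedVectors

section BalancedVectors

/-- An integer vector that represents an element of `M` whose first two coordinates agree up to
sign. -/
structure IsBalancedMinimal (z : Fin 24 → ℤ) : Prop where
  isLeechVector : IsLeechVector z
  dotProduct_self : z ⬝ᵥ z = 32
  abs_eq_abs : |z 0| = |z 1|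

/-- The balanced minimal vectors of shape `(±4, ±4, 0, …, 0)`. -/
def pairVectors : Finset (Fin 24 → ℤ) :=
  signedFamily {t ∈ powersetCard 2 univ | 0 ∈ t ↔ 1 ∈ t} (fun t => 4 * charVec ℤ t) powerset

/-- The balanced minimal vectors of shape `(±2, …, ±2, 0, …, 0)`. -/
noncomputable def octadVectors : Finset (Fin 24 → ℤ) :=
  signedFamily {s ∈ golaySets | #s = 8 ∧ (0 ∈ s ↔ 1 ∈ s)} (fun t => 2 * charVec ℤ t)
    fun t => {s ∈ t.powerset | Even #s}

/-- The balanced minimal vectors of shape `(±3, ±1, …, ±1)`. -/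
noncomputable def oddVectors : Finset (Fin 24 → ℤ) :=
  signedFamily {p | p ≠ 0 ∧ p ≠ 1} (fun p => 1 + 2 * charVec ℤ {p})
    fun p => golaySets.image ({p} ∆ ·)

theorem card_pairVectors : #pairVectors = 928 := by
  rw [pairVectors, card_signedFamily (mul_charVec_injective (c := 4) fun _ => four_ne_zero)
    (fun t => mul_nonneg (by simp) (charVec_nonneg t))]
  · rw [sum_congr rfl fun t ht => by
      rw [card_powerset, (mem_powersetCard.1 (mem_filter.1 ht).1).2], sum_const]
    decide +kernel
  · intro t _ s hs i hi
    simp [charVec, mem_powerset.1 hs hi]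

theorem card_octadVectors : #octadVectors = 52096 := by
  rw [octadVectors, card_signedFamily (mul_charVec_injective (c := 2) fun _ => two_ne_zero)
    (fun t => mul_nonneg (by simp) (charVec_nonneg t))]
  · have hcard : ∀ t ∈ {s ∈ golaySets | #s = 8 ∧ (0 ∈ s ↔ 1 ∈ s)},
        #{s ∈ t.powerset | Even #s} = 128 := fun t ht => by
      have ht8 := (mem_filter.1 ht).2.1
      have := two_mul_card_powerset_filter_even (card_pos.1 (by omega : 0 < #t))
      rw [ht8] at this
      omega
    rw [sum_congr rfl hcard, sum_const, card_filter_octads_balanced]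
    rfl
  · intro t _ s hs i hi
    simp [charVec, mem_powerset.1 (mem_filter.1 hs).1 hi]

theorem card_oddVectors : #oddVectors = 90112 := by
  have hpos (p i : Fin 24) : 0 < (1 + 2 * charVec ℤ {p}) i := by
    have := charVec_nonneg {p} i
    simp only [Pi.zero_apply] at this
    simp only [Pi.add_apply, Pi.mul_apply, Pi.ofNat_apply]
    omega
  rw [oddVectors, card_signedFamily _ (fun p i => (hpos p i).le) fun p _ s _ i _ => (hpos p i).ne']
  · simp only [card_image_of_injective _ (symmDiff_right_injective _), card_golaySets, sum_const]
    decide +kernel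
  · intro p q h
    exact singleton_injective <|
      mul_charVec_injective (c := 2) (fun _ => two_ne_zero) (add_left_cancel h)

theorem IsBalancedMinimal.signed {s : Finset (Fin 24)} {a : Fin 24 → ℤ} (ha : 0 ≤ a)
    (haa : a ⬝ᵥ a = 32) (h01 : a 0 = a 1) (h : IsLeechVector (signed s a)) :
    IsBalancedMinimal (signed s a) :=
  ⟨h, by rw [signed_dotProduct_signed, haa], by rw [abs_signed ha, abs_signed ha, h01]⟩

theorem isLeechVector_signed_four_mul_charVec {s t : Finset (Fin 24)} (ht : #t = 2) :
    IsLeechVector (signed s (4 * charVec ℤ t)) := by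
  refine isLeechVector_iff.2 ⟨0, ∅, empty_mem_golaySets, fun i => ?_, ?_⟩
  · rw [charVec_empty, signed]
    exact Int.modEq_zero_iff_dvd.2 ⟨(1 - 2 * charVec ℤ s i) * charVec ℤ t i, by
      simp only [Pi.mul_apply, Pi.sub_apply, Pi.ofNat_apply]
      ring⟩
  · simp only [sum_signed, Pi.mul_apply, Pi.ofNat_apply, mul_left_comm _ (4 : ℤ), ← mul_sum,
      sum_charVec, ht]
    exact Int.modEq_zero_iff_dvd.2 ⟨1 - ∑ i, charVec ℤ s i * charVec ℤ t i, by ring⟩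

theorem isLeechVector_signed_two_mul_charVec {s t : Finset (Fin 24)} (ht : t ∈ golaySets)
    (ht8 : #t = 8) (hst : s ⊆ t) (hs : Even #s) :
    IsLeechVector (signed s (2 * charVec ℤ t)) := by
  obtain ⟨r, hr⟩ := hs
  refine isLeechVector_iff.2 ⟨0, t, ht, fun i => ?_, ?_⟩
  · refine Int.modEq_iff_dvd.2 ⟨charVec ℤ s i * charVec ℤ t i, ?_⟩
    simp only [signed, Pi.mul_apply, Pi.sub_apply, Pi.ofNat_apply]
    ring
  · have hmul : ∑ i, charVec ℤ s i * charVec ℤ t i = #s := by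
      rw [← sum_charVec]
      refine sum_congr rfl fun i _ => ?_
      have := @hst i
      by_cases hi : i ∈ s <;> simp_all [charVec]
    simp only [sum_signed, Pi.mul_apply, Pi.ofNat_apply, mul_left_comm _ (2 : ℤ), ← mul_sum,
      hmul, sum_charVec, ht8, hr]
    exact Int.modEq_zero_iff_dvd.2 ⟨2 - r, by push_cast; ring⟩

theorem isLeechVector_signed_one_add_two_mul_charVec {p : Fin 24} {w : Finset (Fin 24)}
    (hw : w ∈ golaySets) : IsLeechVector (signed ({p} ∆ w) (1 + 2 * charVec ℤ {p})) := by
  have hsigned : signed ({p} ∆ w) (1 + 2 * charVec ℤ {p}) = signed w (1 - 4 * charVec ℤ {p}) := by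
    rw [symmDiff_comm, signed_symmDiff]
    refine congrArg (signed w) ?_
    rw [signed]
    linear_combination -4 * charVec_mul_self (R := ℤ) {p}
  have hcard : (4 : ℤ) ∣ #w := by
    have := card_mem_of_mem_golaySets hw
    simp only [mem_insert, mem_singleton] at this
    omega
  rw [hsigned]
  refine isLeechVector_iff.2 ⟨1, w, hw, fun i => ?_, ?_⟩
  · refine Int.modEq_iff_dvd.2
      ⟨charVec ℤ w i + charVec ℤ {p} i - 2 * charVec ℤ w i * charVec ℤ {p} i, ?_⟩
    simp only [signed, Pi.mul_apply, Pi.sub_apply, Pi.ofNat_apply]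
    ring
  · obtain ⟨r, hr⟩ := hcard
    simp only [sum_signed, Pi.sub_apply, Pi.mul_apply, Pi.ofNat_apply, mul_sub,
      mul_one, mul_left_comm _ (4 : ℤ), sum_sub_distrib, ← mul_sum, sum_charVec, hr]
    refine Int.modEq_iff_dvd.2 ⟨r - 2 - ∑ i, charVec ℤ w i * charVec ℤ {p} i, ?_⟩
    simp
    ring

theorem isBalancedMinimal_and_sum_abs_of_mem_pairVectors {z : Fin 24 → ℤ} (hz : z ∈ pairVectors) :
    IsBalancedMinimal z ∧ ∑ i, |z i| = 8 := by
  rw [pairVectors, mem_signedFamily] at hz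
  obtain ⟨t, ht, s, -, rfl⟩ := hz
  rw [mem_filter, mem_powersetCard_univ] at ht
  have ha : 0 ≤ 4 * charVec ℤ t := mul_nonneg (by simp) (charVec_nonneg t)
  refine ⟨.signed ha ?_ ?_ (isLeechVector_signed_four_mul_charVec ht.1), ?_⟩
  · simp only [dotProduct, Pi.mul_apply, Pi.ofNat_apply, mul_mul_mul_comm (4 : ℤ), ← mul_sum]
    rw [← dotProduct, charVec_dotProduct_self, ht.1]
    rfl
  · simp [charVec, ht.2]
  · simp only [abs_signed ha, Pi.mul_apply, Pi.ofNat_apply, ← mul_sum, sum_charVec, ht.1]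
    rfl

theorem isBalancedMinimal_and_sum_abs_of_mem_octadVectors {z : Fin 24 → ℤ} (hz : z ∈ octadVectors) :
    IsBalancedMinimal z ∧ ∑ i, |z i| = 16 := by
  rw [octadVectors, mem_signedFamily] at hz
  obtain ⟨t, ht, s, hs, rfl⟩ := hz
  rw [mem_filter] at ht hs
  obtain ⟨ht, ht8, h01⟩ := ht
  have ha : 0 ≤ 2 * charVec ℤ t := mul_nonneg (by simp) (charVec_nonneg t)
  refine ⟨.signed ha ?_ ?_ <|
    isLeechVector_signed_two_mul_charVec ht ht8 (mem_powerset.1 hs.1) hs.2, ?_⟩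
  · simp only [dotProduct, Pi.mul_apply, Pi.ofNat_apply, mul_mul_mul_comm (2 : ℤ), ← mul_sum]
    rw [← dotProduct, charVec_dotProduct_self, ht8]
    rfl
  · simp [charVec, h01]
  · simp only [abs_signed ha, Pi.mul_apply, Pi.ofNat_apply, ← mul_sum, sum_charVec, ht8]
    rfl

theorem isBalancedMinimal_and_sum_abs_of_mem_oddVectors {z : Fin 24 → ℤ} (hz : z ∈ oddVectors) :
    IsBalancedMinimal z ∧ ∑ i, |z i| = 26 := by
  rw [oddVectors, mem_signedFamily] at hz
  obtain ⟨p, hp, s, hs, rfl⟩ := hz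
  obtain ⟨w, hw, rfl⟩ := mem_image.1 hs
  obtain ⟨hp0, hp1⟩ := (mem_filter_univ p).1 hp
  have ha : 0 ≤ 1 + 2 * charVec ℤ {p} :=
    add_nonneg zero_le_one (mul_nonneg (by simp) (charVec_nonneg {p}))
  have hsq : (1 + 2 * charVec ℤ {p}) * (1 + 2 * charVec ℤ {p}) = 1 + 8 * charVec ℤ {p} := by
    linear_combination 4 * charVec_mul_self (R := ℤ) {p}
  refine ⟨.signed ha ?_ ?_ (isLeechVector_signed_one_add_two_mul_charVec hw), ?_⟩
  · calc _ = ∑ i, (1 + 8 * charVec ℤ {p}) i := sum_congr rfl fun i _ => congrFun hsq i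
      _ = 32 := by simp [sum_add_distrib, ← mul_sum, sum_charVec]
  · simp [charVec, hp0.symm, hp1.symm]
  · simp [abs_signed ha, sum_add_distrib, ← mul_sum, sum_charVec]

/-- The integer coordinates of the elements of `K`. -/
noncomputable def balancedVectors : Finset (Fin 24 → ℤ) :=
  pairVectors ∪ octadVectors ∪ oddVectors

theorem isBalancedMinimal_of_mem_balancedVectors {z : Fin 24 → ℤ} (hz : z ∈ balancedVectors) :
    IsBalancedMinimal z := by
  simp only [balancedVectors, mem_union] at hz
  obtain (hz | hz) | hz := hz
  · exact (isBalancedMinimal_and_sum_abs_of_mem_pairVectors hz).1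
  · exact (isBalancedMinimal_and_sum_abs_of_mem_octadVectors hz).1
  · exact (isBalancedMinimal_and_sum_abs_of_mem_oddVectors hz).1

theorem card_balancedVectors : #balancedVectors = 143136 := by
  rw [balancedVectors, card_union_of_disjoint, card_union_of_disjoint, card_pairVectors,
    card_octadVectors, card_oddVectors]
  · refine disjoint_left.2 fun z hz hz' => ?_
    have h := (isBalancedMinimal_and_sum_abs_of_mem_pairVectors hz).2
    rw [(isBalancedMinimal_and_sum_abs_of_mem_octadVectors hz').2] at h
    norm_num at h
  · refine disjoint_left.2 fun z hz hz' => ?_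
    have h := (isBalancedMinimal_and_sum_abs_of_mem_oddVectors hz').2
    obtain hz | hz := mem_union.1 hz
    · rw [(isBalancedMinimal_and_sum_abs_of_mem_pairVectors hz).2] at h
      norm_num at h
    · rw [(isBalancedMinimal_and_sum_abs_of_mem_octadVectors hz).2] at h
      norm_num at h

/-- The set `K`: elements of `M` whose first two coordinates agree up to sign. -/
noncomputable def balancedPoints : Set (EuclideanSpace ℝ (Fin 24)) := leechPoint '' balancedVectors

theorem ncard_balancedPoints : balancedPoints.ncard = 143136 := by
  rw [balancedPoints, Set.ncard_image_of_injective _ leechPoint_injective, Set.ncard_coe_finset,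
    card_balancedVectors]

theorem balancedPoints_subset_M : balancedPoints ⊆ M := by
  rintro _ ⟨z, hz, rfl⟩
  have h := isBalancedMinimal_of_mem_balancedVectors hz
  exact leechPoint_mem_M h.isLeechVector h.dotProduct_self

theorem abs_eq_abs_of_mem_balancedPoints {x : EuclideanSpace ℝ (Fin 24)}
    (hx : x ∈ balancedPoints) : |x 0| = |x 1| := by
  obtain ⟨z, hz, rfl⟩ := hx
  have h := (isBalancedMinimal_of_mem_balancedVectors hz).abs_eq_abs
  simp only [leechPoint, abs_div]
  rw [← Int.cast_abs, ← Int.cast_abs, h]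

end BalancedVectors

section QuadraticMonomials

variable {κ R : Type*} [LinearOrder κ]

/-- The index set of the monomials `x i ^ 2`, `x i` and `x i * x j` with `i < j`. -/
abbrev MonomialIndex (κ : Type*) [LinearOrder κ] : Type _ := κ ⊕ κ ⊕ {p : κ × κ // p.1 < p.2}

/-- The values at `x` of the monomials of degree one and two. -/
def monomialVec [Monoid R] (x : κ → R) : MonomialIndex κ → R :=
  Sum.elim (fun i => x i ^ 2) (Sum.elim x fun p => x p.1.1 * x p.1.2)

/-- The weights for which the diagonal form on monomial vectors is `a * ⟪x, y⟫ ^ 2 + b * ⟪x, y⟫`. -/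
def monomialWeight [Semiring R] (a b : R) : MonomialIndex κ → R :=
  Sum.elim (fun _ => a) (Sum.elim (fun _ => b) fun _ => 2 * a)

variable [Fintype κ]

theorem sum_sq_eq_sum_sq_add [CommSemiring R] (c : κ → R) :
    (∑ i, c i) ^ 2 = ∑ i, c i ^ 2 + 2 * ∑ p : {p : κ × κ // p.1 < p.2}, c p.1.1 * c p.1.2 := by
  have hpairs : ∑ p : {p : κ × κ // p.1 < p.2}, c p.1.1 * c p.1.2 =
      ∑ i, ∑ j, if i < j then c i * c j else 0 := by
    rw [← Fintype.sum_prod_type', ← sum_filter, ← sum_subtype_eq_sum_filter, subtype_univ]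
  have htrichotomy (i j : κ) : c i * c j = (if i = j then c i * c j else 0) +
      ((if i < j then c i * c j else 0) + if j < i then c j * c i else 0) := by
    obtain h | rfl | h := lt_trichotomy i j
    · simp [h, h.ne, h.not_gt]
    · simp
    · simp [h, h.ne', h.not_gt, mul_comm]
  rw [sq, sum_mul_sum, hpairs, sum_congr rfl fun i _ => sum_congr rfl fun j _ => htrichotomy i j]
  simp only [sum_add_distrib, sum_ite_eq, mem_univ, if_true, sq, two_mul]
  rw [sum_comm (f := fun i j => if j < i then c j * c i else 0)]

theorem sum_monomialWeight_mul [CommSemiring R] (a b : R) (x y : κ → R) :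
    ∑ k, monomialWeight a b k * (monomialVec x k * monomialVec y k) =
      a * (x ⬝ᵥ y) ^ 2 + b * (x ⬝ᵥ y) := by
  rw [dotProduct, sum_sq_eq_sum_sq_add, Fintype.sum_sum_type, Fintype.sum_sum_type]
  simp only [monomialWeight, monomialVec, Sum.elim_inl, Sum.elim_inr, ← mul_sum, mul_pow,
    mul_mul_mul_comm (x _)]
  ring

end QuadraticMonomials

section RankBounds

open Matrix

variable {ι κ : Type*} [Fintype ι] [DecidableEq ι] [Fintype κ]

theorem det_map_intCast_ne_zero (R : Type*) {K : Type*} [CommRing R] [CommRing K] [CharZero K]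
    {N : Matrix ι ι ℤ} (h : (N.map (Int.cast : ℤ → R)).det ≠ 0) :
    (N.map (Int.cast : ℤ → K)).det ≠ 0 := by
  have hR : (N.map (Int.cast : ℤ → R)).det = N.det := ((Int.castRingHom R).map_det N).symm
  have hK : (N.map (Int.cast : ℤ → K)).det = N.det := ((Int.castRingHom K).map_det N).symm
  rw [hK, Int.cast_ne_zero]
  exact fun h0 => h (by rw [hR, h0, Int.cast_zero])

theorem card_le_card_of_det_mul_ne_zero {K : Type*} [Field K] (U : Matrix ι κ K)
    (V : Matrix κ ι K) (h : (U * V).det ≠ 0) : Fintype.card ι ≤ Fintype.card κ := by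
  rw [← rank_of_isUnit (U * V) ((isUnit_iff_isUnit_det _).2 h.isUnit)]
  exact (rank_mul_le_left U V).trans (rank_le_card_width U)

theorem det_ones_sub_one_ne_zero (R : Type*) [CommRing R] [Nontrivial R]
    (h : (Fintype.card ι : R) = 0) : (of (fun _ _ => 1) - 1 : Matrix ι ι R).det ≠ 0 := by
  have hones : (of fun _ _ => 1 : Matrix ι ι R) * of (fun _ _ => 1) = 0 := by
    ext i j
    simp [mul_apply, h]
  have hinv : (of (fun _ _ => 1) - 1 : Matrix ι ι R) * -(of (fun _ _ => 1) + 1) = 1 := by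
    rw [mul_neg, sub_mul, mul_add, hones, mul_one, one_mul]
    abel
  intro hdet
  have := congrArg det hinv
  rw [det_mul, hdet, zero_mul, det_one] at this
  exact zero_ne_one this

end RankBounds

section FewInnerProducts

open Module

-- Twice the Gram matrix is odd off the diagonal and even on it; modulo `2` such a matrix is
-- invertible as soon as its size is even.
theorem card_le_finrank_add_one_of_inner_eq_half {E : Type*} [NormedAddCommGroup E]
    [InnerProductSpace ℝ E] [FiniteDimensional ℝ E] {S : Finset E} (hnorm : ∀ x ∈ S, ‖x‖ = 1)
    (h : ∀ x ∈ S, ∀ y ∈ S, x ≠ y → inner ℝ x y ∈ ({-1 / 2, 1 / 2} : Set ℝ)) :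
    #S ≤ finrank ℝ E + 1 := by
  classical
  by_contra! hS
  obtain ⟨n, hn, hnS, hneven⟩ : ∃ n, finrank ℝ E < n ∧ n ≤ #S ∧ Even n := by
    obtain he | ho := Nat.even_or_odd (finrank ℝ E)
    · exact ⟨_, by omega, hS, he.add even_two⟩
    · exact ⟨_, by omega, hS.le, ho.add_one⟩
  obtain ⟨P, hPS, rfl⟩ := exists_subset_card_eq hnS
  simp only [Set.mem_insert_iff, Set.mem_singleton_iff] at h
  let N : Matrix P P ℤ := fun x y => if x = y then 2 else if inner ℝ x.1 y.1 = -1 / 2 then -1 else 1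
  have hgram : N.map (Int.cast : ℤ → ℝ) = (2 : ℝ) • Matrix.gram ℝ ((↑) : P → E) := by
    ext x y
    rw [Matrix.map_apply, Matrix.smul_apply, Matrix.gram_apply, smul_eq_mul]
    by_cases hxy : x = y
    · simp [N, hxy, hnorm y.1 (hPS y.2)]
    · obtain hi | hi := h x (hPS x.2) y (hPS y.2) (Subtype.coe_injective.ne hxy) <;>
        norm_num [N, hxy, hi]
  have hmod : N.map (Int.cast : ℤ → ZMod 2) = Matrix.of (fun _ _ => 1) - 1 := by
    ext x y
    rw [Matrix.map_apply, Matrix.sub_apply, Matrix.of_apply, Matrix.one_apply]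
    simp only [N]
    split_ifs <;> decide
  have hdet : (N.map (Int.cast : ℤ → ℝ)).det ≠ 0 := det_map_intCast_ne_zero (ZMod 2) <| by
    rw [hmod]
    refine det_ones_sub_one_ne_zero (ZMod 2) ?_
    rwa [Fintype.card_coe, ZMod.natCast_eq_zero_iff_even]
  rw [hgram, Matrix.det_smul] at hdet
  have := (Matrix.linearIndependent_of_det_gram_ne_zero
    (right_ne_zero_of_mul hdet)).fintype_card_le_finrank
  rw [Fintype.card_coe] at this
  omega

variable {κ : Type*} [Fintype κ] [LinearOrder κ]

-- The polynomial `8 / 3 * t ^ 2 - 2 * t + 1 / 3` is `1` at `1`, `2` at `-1 / 2` and vanishes at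
-- `1 / 4` and `1 / 2`, so its values on inner products form an integer matrix that is the identity
-- modulo `2`. Its constant term costs no extra monomial, being `∑ i, y i ^ 2 / 3` on unit vectors.
theorem card_le_card_monomialIndex_of_inner_mem {S : Finset (EuclideanSpace ℝ κ)}
    (hnorm : ∀ x ∈ S, ‖x‖ = 1)
    (h : ∀ x ∈ S, ∀ y ∈ S, x ≠ y → inner ℝ x y ∈ ({-1 / 2, 1 / 4, 1 / 2} : Set ℝ)) :
    #S ≤ Fintype.card (MonomialIndex κ) := by
  classical
  simp only [Set.mem_insert_iff, Set.mem_singleton_iff] at h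
  let N : Matrix S S ℤ := fun x y => if x = y then 1 else if inner ℝ x.1 y.1 = -1 / 2 then 2 else 0
  let U : Matrix S (MonomialIndex κ) ℝ := fun x k =>
    monomialWeight (8 / 3) (-2) k * monomialVec x.1.ofLp k + Sum.elim (fun _ => 1 / 3) 0 k
  let V : Matrix (MonomialIndex κ) S ℝ := fun k y => monomialVec y.1.ofLp k
  have hUV (x y : S) : (U * V) x y = 8 / 3 * inner ℝ x.1 y.1 ^ 2 - 2 * inner ℝ x.1 y.1 + 1 / 3 := by
    have hy : ∑ i, y.1 i ^ 2 = 1 := by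
      rw [← EuclideanSpace.real_norm_sq_eq, hnorm y.1 y.2, one_pow]
    have hinner : inner ℝ x.1 y.1 = x.1.ofLp ⬝ᵥ y.1.ofLp := dotProduct_comm _ _
    rw [Matrix.mul_apply, hinner]
    simp only [U, V, add_mul, sum_add_distrib, mul_assoc]
    rw [sum_monomialWeight_mul]
    simp [monomialVec, ← mul_sum, hy]
    ring
  have hN : U * V = N.map (Int.cast : ℤ → ℝ) := by
    ext x y
    rw [hUV, Matrix.map_apply]
    by_cases hxy : x = y
    · norm_num [N, hxy, hnorm y.1 y.2]
    · obtain hi | hi | hi := h x x.2 y y.2 (Subtype.coe_injective.ne hxy) <;>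
        norm_num [N, hxy, hi]
  have hmod : N.map (Int.cast : ℤ → ZMod 2) = 1 := by
    ext x y
    rw [Matrix.map_apply, Matrix.one_apply]
    simp only [N]
    split_ifs <;> decide
  rw [← Fintype.card_coe S]
  refine card_le_card_of_det_mul_ne_zero U V ?_
  rw [hN]
  exact det_map_intCast_ne_zero (ZMod 2) (by rw [hmod, Matrix.det_one]; exact one_ne_zero)

theorem exists_subset_forall_neg_notMem {α : Type*} [InvolutiveNeg α] [DecidableEq α]
    {S : Finset α} (hS : ∀ x ∈ S, -x ≠ x) :
    ∃ A ⊆ S, (∀ x ∈ A, -x ∉ A) ∧ ∀ x ∈ S \ A, -x ∈ A := by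
  induction S using Finset.induction_on with
  | empty => exact ⟨∅, by simp⟩
  | insert a S _ ih =>
    obtain ⟨A, hAS, hA, hSA⟩ := ih fun x hx => hS x (mem_insert_of_mem hx)
    by_cases hneg : -a ∈ A
    · refine ⟨A, hAS.trans (subset_insert a S), hA, fun x hx => ?_⟩
      grind
    · refine ⟨insert a A, insert_subset_insert a hAS, fun x hx => ?_, fun x hx => ?_⟩
      · have := hS a (mem_insert_self a S)
        have := neg_neg x
        grind
      · grind

theorem card_le_card_monomialIndex_add_of_inner_mem {S : Finset (EuclideanSpace ℝ κ)}
    (hnorm : ∀ x ∈ S, ‖x‖ = 1)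
    (h : ∀ x ∈ S, ∀ y ∈ S, x ≠ y → inner ℝ x y ∈ ({-1, -1 / 2, 1 / 4, 1 / 2} : Set ℝ)) :
    #S ≤ Fintype.card (MonomialIndex κ) + (Fintype.card κ + 1) := by
  classical
  have hneg_ne : ∀ x ∈ S, -x ≠ x := fun x hx hxx =>
    ne_neg_of_mem_unit_sphere ℝ ⟨x, mem_sphere_zero_iff_norm.2 (hnorm x hx)⟩
      (Subtype.ext hxx.symm)
  have hantipodal : ∀ x ∈ S, ∀ y ∈ S, inner ℝ x y = -1 → x = -y := fun x hx y hy hxy =>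
    (inner_eq_one_iff_of_norm_eq_one (𝕜 := ℝ) (hnorm x hx) (by rw [norm_neg, hnorm y hy])).1
      (by rw [inner_neg_right, hxy, neg_neg])
  obtain ⟨A, hAS, hA, hSA⟩ := exists_subset_forall_neg_notMem hneg_ne
  have hcardA : #A ≤ Fintype.card (MonomialIndex κ) := by
    refine card_le_card_monomialIndex_of_inner_mem (fun x hx => hnorm x (hAS hx))
      fun x hx y hy hxy => (h x (hAS hx) y (hAS hy) hxy).resolve_left fun hinner => ?_
    exact hA y hy (hantipodal x (hAS hx) y (hAS hy) hinner ▸ hx)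
  have hcardSA : #(S \ A) ≤ Fintype.card κ + 1 := by
    rw [← finrank_euclideanSpace (𝕜 := ℝ) (ι := κ)]
    refine card_le_finrank_add_one_of_inner_eq_half (fun x hx => hnorm x (mem_sdiff.1 hx).1)
      fun x hx y hy hxy => ?_
    have hxS := (mem_sdiff.1 hx).1
    have hyS := (mem_sdiff.1 hy).1
    have hne : x ≠ -y := fun hxy => (mem_sdiff.1 hx).2 (hxy ▸ hSA y hy)
    obtain hinner | hinner | hinner | (hinner : _ = _) := h x hxS y hyS hxy
    · exact absurd (hantipodal x hxS y hyS hinner) hne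
    · exact Or.inl hinner
    · have := h x hxS (-y) (hAS (hSA y hy)) hne
      rw [inner_neg_right, hinner] at this
      norm_num at this
    · exact Or.inr hinner
  rw [← card_sdiff_add_card_eq_card hAS]
  omega

end FewInnerProducts

theorem encard_le_of_forall_finset_card_le {α : Type*} {A : Set α} {n : ℕ}
    (h : ∀ S : Finset α, (S : Set α) ⊆ A → #S ≤ n) : A.encard ≤ n := by
  by_contra! hA
  obtain ⟨B, hBA, hB⟩ := Set.exists_subset_encard_eq (Order.add_one_le_of_lt hA)
  lift B to Finset α using Set.finite_of_encard_eq_coe (k := n + 1) hB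
  rw [Set.encard_coe_eq_coe_finsetCard] at hB
  have : #B = n + 1 := mod_cast hB
  have := h B hBA
  omega

section Phi

variable (b : OrthonormalBasis BasisIndex ℝ (EuclideanSpace ℝ (Fin 324)))
  {x y : EuclideanSpace ℝ (Fin 24)}

theorem inner_basis_Phi (x : EuclideanSpace ℝ (Fin 24)) (k : BasisIndex) :
    inner ℝ (b k) (Phi b x) = √(monomialWeight (4 / 5) (1 / 5) k) * monomialVec x.ofLp k := by
  have h4 : √4 = (2 : ℝ) := by rw [Real.sqrt_eq_iff_mul_self_eq] <;> norm_num
  have h8 : √8 = 2 * √2 := by rw [← h4, ← Real.sqrt_mul] <;> norm_num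
  have hsum : Phi b x =
      ∑ k, (√(monomialWeight (4 / 5) (1 / 5) k) * monomialVec x.ofLp k) • b k := by
    rw [Fintype.sum_sum_type, Fintype.sum_sum_type]
    norm_num [Phi, monomialWeight, monomialVec, smul_sum, smul_smul, add_assoc, h4, h8]
  rw [hsum, b.orthonormal.inner_right_fintype]

theorem inner_Phi (x y : EuclideanSpace ℝ (Fin 24)) :
    inner ℝ (Phi b x) (Phi b y) = (4 * inner ℝ x y ^ 2 + inner ℝ x y) / 5 := by
  have hinner : inner ℝ x y = x.ofLp ⬝ᵥ y.ofLp := dotProduct_comm _ _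
  have hweight (k : BasisIndex) : (0 : ℝ) ≤ monomialWeight (4 / 5) (1 / 5) k := by
    obtain i | i | p := k <;> norm_num [monomialWeight]
  have hterm (k : BasisIndex) : inner ℝ (Phi b x) (b k) * inner ℝ (b k) (Phi b y) =
      monomialWeight (4 / 5) (1 / 5) k * (monomialVec x.ofLp k * monomialVec y.ofLp k) := by
    rw [real_inner_comm, inner_basis_Phi, inner_basis_Phi, mul_mul_mul_comm,
      Real.mul_self_sqrt (hweight k)]
  rw [← b.sum_inner_mul_inner, sum_congr rfl fun k _ => hterm k]
  rw [sum_monomialWeight_mul, hinner]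
  ring

theorem Phi_injective : Function.Injective (Phi b) := by
  intro x y hxy
  ext i
  have hi := inner_basis_Phi b x (Sum.inr (Sum.inl i))
  rw [hxy, inner_basis_Phi] at hi
  exact (mul_left_cancel₀ (by norm_num [monomialWeight]) hi).symm

theorem norm_Phi (hx : x ∈ M) : ‖Phi b x‖ = 1 := by
  rw [← pow_eq_one_iff_of_nonneg (norm_nonneg _) two_ne_zero, ← real_inner_self_eq_norm_sq,
    inner_Phi, real_inner_self_eq_norm_sq, hx.2]
  norm_num

theorem dist_Phi_sq (hx : x ∈ M) (hy : y ∈ M) :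
    dist (Phi b x) (Phi b y) ^ 2 = 2 - 2 * ((4 * inner ℝ x y ^ 2 + inner ℝ x y) / 5) := by
  rw [dist_eq_norm, norm_sub_sq_real, norm_Phi b hx, norm_Phi b hy, inner_Phi]
  ring

theorem dist_Phi_le (hx : x ∈ M) (hy : y ∈ M) : dist (Phi b x) (Phi b y) ≤ √2 := by
  refine Real.le_sqrt_of_sq_le ?_
  rw [dist_Phi_sq b hx hy]
  have := inner_mem_of_mem_M hx hy
  simp only [Set.mem_insert_iff, Set.mem_singleton_iff] at this
  rcases this with h | h | h | h | h | h | h <;> rw [h] <;> norm_num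

theorem isBounded_Phi_image_M : Bornology.IsBounded (Phi b '' M) :=
  Metric.isBounded_iff.2 ⟨√2, Set.forall_mem_image.2 fun _ hx =>
    Set.forall_mem_image.2 fun _ hy => dist_Phi_le b hx hy⟩

theorem inner_mem_of_dist_Phi_lt (hx : x ∈ M) (hy : y ∈ M) (hxy : x ≠ y)
    (h : dist (Phi b x) (Phi b y) < √2) :
    inner ℝ x y ∈ ({-1, -1 / 2, 1 / 4, 1 / 2} : Set ℝ) := by
  have hsq : dist (Phi b x) (Phi b y) ^ 2 < 2 := (Real.lt_sqrt dist_nonneg).1 h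
  rw [dist_Phi_sq b hx hy] at hsq
  have hne : inner ℝ x y ≠ 1 := mt (inner_eq_one_iff_of_norm_eq_one hx.2 hy.2).1 hxy
  have := inner_mem_of_mem_M hx hy
  simp only [Set.mem_insert_iff, Set.mem_singleton_iff] at this ⊢
  have hne' : inner ℝ x y ≠ -1 / 4 := fun h => by norm_num [h] at hsq
  have hne0 : inner ℝ x y ≠ 0 := fun h => by norm_num [h] at hsq
  tauto

theorem encard_le_of_diam_lt_diam_Phi_image_M {T : Set (EuclideanSpace ℝ (Fin 324))}
    (hT : T ⊆ Phi b '' M) (hdiam : Metric.diam T < Metric.diam (Phi b '' M)) :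
    T.encard ≤ 349 := by
  obtain ⟨A, hAM, rfl⟩ := Set.subset_image_iff.1 hT
  rw [(Phi_injective b).encard_image]
  have hdiamM : Metric.diam (Phi b '' M) ≤ √2 :=
    Metric.diam_le_of_forall_dist_le (Real.sqrt_nonneg _) <| Set.forall_mem_image.2 fun _ hx =>
      Set.forall_mem_image.2 fun _ hy => dist_Phi_le b hx hy
  have hinner : ∀ x ∈ A, ∀ y ∈ A, x ≠ y → inner ℝ x y ∈ ({-1, -1 / 2, 1 / 4, 1 / 2} : Set ℝ) :=
    fun x hx y hy hxy => inner_mem_of_dist_Phi_lt b (hAM hx) (hAM hy) hxy <|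
      ((Metric.dist_le_diam_of_mem ((isBounded_Phi_image_M b).subset hT)
        (Set.mem_image_of_mem _ hx) (Set.mem_image_of_mem _ hy)).trans_lt hdiam).trans_le hdiamM
  have hcard : Nat.card (MonomialIndex (Fin 24)) = 324 := by
    rw [← Module.finrank_eq_nat_card_basis b.toBasis, finrank_euclideanSpace_fin]
  refine encard_le_of_forall_finset_card_le fun S hS => ?_
  have := card_le_card_monomialIndex_add_of_inner_mem (fun x hx => (hAM (hS hx)).2)
    fun x hx y hy => hinner x (hS hx) y (hS hy)
  rwa [← Nat.card_eq_fintype_card, hcard, Fintype.card_fin] at this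

end Phi

section Hyperplanes

open Module

theorem exists_affineSubspace_of_linearIndependent {ι E : Type*} [Fintype ι]
    [NormedAddCommGroup E] [InnerProductSpace ℝ E] [FiniteDimensional ℝ E] {v : ι → E}
    (hv : LinearIndependent ℝ v) (p : E) :
    ∃ S : AffineSubspace ℝ E, Fintype.card ι + finrank ℝ S.direction = finrank ℝ E ∧
      ∀ z, (∀ i, inner ℝ (v i) z = inner ℝ (v i) p) → z ∈ S := by
  refine ⟨.mk' p (Submodule.span ℝ (Set.range v))ᗮ, ?_, fun z hz => ?_⟩
  · rw [AffineSubspace.direction_mk', ← finrank_span_eq_card hv,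
      Submodule.finrank_add_finrank_orthogonal]
  · have hspan : Submodule.span ℝ (Set.range v) ≤ (ℝ ∙ (z - p))ᗮ :=
      Submodule.span_le.2 <| Set.range_subset_iff.2 fun i =>
        Submodule.mem_orthogonal_singleton_iff_inner_left.2 <| by
          rw [inner_sub_right, hz, sub_self]
    exact fun w hw => Submodule.mem_orthogonal_singleton_iff_inner_left.1 (hspan hw)

variable (b : OrthonormalBasis BasisIndex ℝ (EuclideanSpace ℝ (Fin 324))) {k l : Fin 24}

theorem linearIndependent_sub_sum (hkl : k ≠ l) :
    LinearIndependent ℝ ![b (Sum.inl k) - b (Sum.inl l), ∑ i, b (Sum.inl i)] := by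
  refine LinearIndependent.pair_iff.2 fun s t hst => ?_
  have hinner (i : Fin 24) :
      s * ((if i = k then 1 else 0) - if i = l then 1 else 0) + t = 0 := by
    have := congrArg (inner ℝ (b (Sum.inl i))) hst
    simpa [inner_add_right, inner_smul_right, inner_sub_right, inner_sum, b.inner_eq_ite] using this
  have hk := hinner k
  have hl := hinner l
  simp only [hkl, hkl.symm, if_true, if_false] at hk hl
  constructor <;> linarith

-- On `Φ(K)` the coordinates along `e k` and `e l` agree, and those along the `e i` have sum
-- `2 / √5` because `‖x‖ = 1`.
theorem exists_affineSubspace_Phi_image {K : Set (EuclideanSpace ℝ (Fin 24))} (hkl : k ≠ l)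
    (hKM : K ⊆ M) (hK : K.Nonempty) (h : ∀ x ∈ K, |x k| = |x l|) :
    ∃ S : AffineSubspace ℝ (EuclideanSpace ℝ (Fin 324)),
      finrank ℝ S.direction = 322 ∧ Phi b '' K ⊆ S := by
  obtain ⟨x₀, hx₀⟩ := hK
  obtain ⟨S, hS, hmem⟩ :=
    exists_affineSubspace_of_linearIndependent (linearIndependent_sub_sum b hkl) (Phi b x₀)
  rw [Fintype.card_fin, finrank_euclideanSpace_fin] at hS
  have hcoord (x : EuclideanSpace ℝ (Fin 24)) (i : Fin 24) :
      inner ℝ (b (Sum.inl i)) (Phi b x) = √(4 / 5) * x i ^ 2 := inner_basis_Phi b x (Sum.inl i)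
  have hsub : ∀ x ∈ K, inner ℝ (b (Sum.inl k) - b (Sum.inl l)) (Phi b x) = 0 := fun x hx => by
    rw [inner_sub_left, hcoord, hcoord, (sq_eq_sq_iff_abs_eq_abs _ _).2 (h x hx), sub_self]
  have hsum : ∀ x ∈ K, inner ℝ (∑ i, b (Sum.inl i)) (Phi b x) = √(4 / 5) := fun x hx => by
    simp only [sum_inner, hcoord]
    rw [← mul_sum, ← EuclideanSpace.real_norm_sq_eq, (hKM hx).2, one_pow, mul_one]
  refine ⟨S, by omega, Set.image_subset_iff.2 fun x hx => hmem _ (Fin.forall_fin_two.2 ⟨?_, ?_⟩)⟩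
  · exact (hsub x hx).trans (hsub x₀ hx₀).symm
  · exact (hsum x hx).trans (hsum x₀ hx₀).symm

end Hyperplanes

section BorsukNumber

open Metric

theorem exists_forall_subset_iUnion_closedBall (E : Type*) [NormedAddCommGroup E]
    [NormedSpace ℝ E] [ProperSpace E] {r : ℝ} (hr : 0 < r) :
    ∃ m : ℕ, ∀ A : Set E, Bornology.IsBounded A → A.Nontrivial →
      ∃ c : Fin m → E, A ⊆ ⋃ i, closedBall (c i) (r * diam A) := by
  obtain ⟨t, -, htfin, hcover⟩ :=
    (isCompact_closedBall (0 : E) 1).finite_cover_balls hr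
  lift t to Finset E using htfin
  refine ⟨#t, fun A hbdd hA => ?_⟩
  have hdiam : 0 < diam A := diam_pos hA hbdd
  obtain ⟨a, ha⟩ := hA.nonempty
  refine ⟨fun i => a + diam A • (t.equivFin.symm i).1, fun x hx => ?_⟩
  obtain ⟨p, hp, hxp⟩ : ∃ p ∈ t, ‖(diam A)⁻¹ • (x - a) - p‖ < r := by
    have hmem : (diam A)⁻¹ • (x - a) ∈ closedBall (0 : E) 1 := by
      rw [mem_closedBall_zero_iff, norm_smul, norm_inv, Real.norm_of_nonneg hdiam.le,
        inv_mul_le_one₀ hdiam, ← dist_eq_norm]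
      exact dist_le_diam_of_mem hbdd hx ha
    simpa [dist_eq_norm] using hcover hmem
  have hsub : x - (a + diam A • p) = diam A • ((diam A)⁻¹ • (x - a) - p) := by
    rw [smul_sub, smul_inv_smul₀ hdiam.ne']
    abel
  refine Set.mem_iUnion.2 ⟨t.equivFin ⟨p, hp⟩, ?_⟩
  simp only [Equiv.symm_apply_apply]
  rw [mem_closedBall_iff_norm, hsub, norm_smul, Real.norm_of_nonneg hdiam.le, mul_comm]
  gcongr

theorem exists_partitionsIntoSmaller (n : ℕ) : ∃ m : ℕ, ∀ A : Set (EuclideanSpace ℝ (Fin n)),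
    Bornology.IsBounded A → A.Nontrivial → PartitionsIntoSmaller A m := by
  obtain ⟨m, hm⟩ := exists_forall_subset_iUnion_closedBall (EuclideanSpace ℝ (Fin n))
    (r := 1 / 4) (by norm_num)
  refine ⟨m, fun A hbdd hA => ?_⟩
  obtain ⟨c, hc⟩ := hm A hbdd hA
  have hdiam : 0 < diam A := diam_pos hA hbdd
  refine ⟨disjointed fun i => A ∩ closedBall (c i) (1 / 4 * diam A), ?_,
    disjoint_disjointed _, fun i => ?_⟩
  · rw [iUnion_disjointed, ← Set.inter_iUnion, Set.inter_eq_left.2 hc]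
  · calc diam _ ≤ diam (closedBall (c i) (1 / 4 * diam A)) :=
          diam_mono ((disjointed_subset _ i).trans Set.inter_subset_right) isBounded_closedBall
      _ ≤ 2 * (1 / 4 * diam A) := diam_closedBall (by positivity)
      _ < diam A := by linarith

theorem ncard_le_mul_borsukNumber {n m : ℕ} {A : Set (EuclideanSpace ℝ (Fin n))}
    (hbdd : Bornology.IsBounded A) (hA : A.Nontrivial)
    (h : ∀ T ⊆ A, diam T < diam A → T.encard ≤ m) : A.ncard ≤ m * borsukNumber n := by
  obtain ⟨P, hPA, -, hdiam⟩ := Nat.sInf_mem (exists_partitionsIntoSmaller n) A hbdd hA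
  have hP (i) : (P i).ncard ≤ m :=
    (Set.encard_le_coe_iff_finite_ncard_le.1
      (h (P i) (hPA ▸ Set.subset_iUnion P i) (hdiam i))).2
  calc A.ncard = (⋃ i, P i).ncard := by rw [hPA]
    _ ≤ ∑ i, (P i).ncard := Set.ncard_iUnion_le_of_fintype P
    _ ≤ ∑ _, m := sum_le_sum fun i _ => hP i
    _ = m * borsukNumber n := by
      rw [sum_const, card_univ, Fintype.card_fin, smul_eq_mul, mul_comm]
      rfl

theorem exists_isometry_range_eq_affineSubspace {E : Type*} [NormedAddCommGroup E]
    [InnerProductSpace ℝ E] [FiniteDimensional ℝ E] {S : AffineSubspace ℝ E}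
    (hS : (S : Set E).Nonempty) {n : ℕ} (hn : Module.finrank ℝ S.direction = n) :
    ∃ g : EuclideanSpace ℝ (Fin n) → E, Isometry g ∧ Set.range g = S := by
  obtain ⟨p, hp⟩ := hS
  let e := ((stdOrthonormalBasis ℝ S.direction).reindex (finCongr hn)).repr.symm
  refine ⟨fun y => (e y : E) +ᵥ p, ?_, ?_⟩
  · exact (IsometryEquiv.vaddConst p).isometry.comp
      (S.direction.subtypeₗᵢ.isometry.comp e.isometry)
  · ext x
    constructor
    · rintro ⟨y, rfl⟩
      exact AffineSubspace.vadd_mem_of_mem_direction (e y).2 hp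
    · intro hx
      obtain ⟨y, hy⟩ := e.surjective ⟨x -ᵥ p, AffineSubspace.vsub_mem_direction hx hp⟩
      exact ⟨y, by simp [hy]⟩

theorem ncard_le_mul_borsukNumber_of_subset_affineSubspace {E : Type*} [NormedAddCommGroup E]
    [InnerProductSpace ℝ E] [FiniteDimensional ℝ E] {n m : ℕ} {B : Set E}
    (hbdd : Bornology.IsBounded B) (hB : B.Nontrivial) {S : AffineSubspace ℝ E}
    (hn : Module.finrank ℝ S.direction = n) (hBS : B ⊆ S)
    (h : ∀ T ⊆ B, diam T < diam B → T.encard ≤ m) : B.ncard ≤ m * borsukNumber n := by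
  obtain ⟨g, hg, hrange⟩ := exists_isometry_range_eq_affineSubspace (hB.nonempty.mono hBS) hn
  obtain ⟨A, rfl⟩ := Set.subset_range_iff_exists_image_eq.1 (hBS.trans hrange.ge)
  rw [Set.ncard_image_of_injective A hg.injective]
  refine ncard_le_mul_borsukNumber
    ((hg.antilipschitz.isBounded_preimage hbdd).subset (Set.subset_preimage_image g A))
    (Set.nontrivial_of_image g A hB) fun T hTA hT => ?_
  rw [← hg.injective.encard_image]
  exact h (g '' T) (Set.image_mono hTA) (by rwa [hg.diam_image, hg.diam_image])

end BorsukNumber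

theorem ncard_le_mul_borsukNumber_of_abs_eq_abs {K : Set (EuclideanSpace ℝ (Fin 24))}
    {k l : Fin 24} (hkl : k ≠ l) (hKM : K ⊆ M) (hK : K.Nontrivial) (h : ∀ x ∈ K, |x k| = |x l|) :
    K.ncard ≤ 349 * borsukNumber 322 := by
  obtain ⟨b⟩ := nonempty_orthonormalBasis
  obtain ⟨S, hS, hKS⟩ := exists_affineSubspace_Phi_image b hkl hKM hK.nonempty h
  have hsub : Phi b '' K ⊆ Phi b '' M := Set.image_mono hKM
  have hbdd := isBounded_Phi_image_M b
  rw [← Set.ncard_image_of_injective K (Phi_injective b)]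
  refine ncard_le_mul_borsukNumber_of_subset_affineSubspace (hbdd.subset hsub)
    (hK.image (Phi_injective b)) hS hKS fun T hT hdiam => ?_
  exact encard_le_of_diam_lt_diam_Phi_image_M b (hT.trans hsub)
    (hdiam.trans_le (Metric.diam_mono hsub hbdd))

end Borsuk

theorem mainTheorem2_general :
    ∃ (K : Set (EuclideanSpace ℝ (Fin 24))) (k l : Fin 24),
      K ⊆ Borsuk.M ∧ K.ncard = 143136 ∧ k < l ∧ (∀ x ∈ K, |x k| = |x l|) ∧
      (∀ b : OrthonormalBasis Borsuk.BasisIndex ℝ (EuclideanSpace ℝ (Fin 324)),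
        (∃ S : AffineSubspace ℝ (EuclideanSpace ℝ (Fin 324)),
          Module.finrank ℝ S.direction = 322 ∧ Borsuk.Phi b '' K ⊆ S) ∧
        (∀ T : Set (EuclideanSpace ℝ (Fin 324)), T ⊆ Borsuk.Phi b '' Borsuk.M →
          Metric.diam T < Metric.diam (Borsuk.Phi b '' Borsuk.M) → T.encard ≤ 349)) ∧
      411 ≤ Borsuk.borsukNumber 322 := by
  have hcard := Borsuk.ncard_balancedPoints
  have hsub := Borsuk.balancedPoints_subset_M
  have habs : ∀ x ∈ Borsuk.balancedPoints, |x 0| = |x 1| :=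
    fun _ => Borsuk.abs_eq_abs_of_mem_balancedPoints
  have hnontrivial : Borsuk.balancedPoints.Nontrivial :=
    (Set.one_lt_ncard_iff_nontrivial_and_finite.1 (by rw [hcard]; norm_num)).1
  have hborsuk :=
    Borsuk.ncard_le_mul_borsukNumber_of_abs_eq_abs zero_ne_one hsub hnontrivial habs
  exact ⟨Borsuk.balancedPoints, 0, 1, hsub, hcard, by decide, habs,
    fun b => ⟨Borsuk.exists_affineSubspace_Phi_image b zero_ne_one hsub hnontrivial.nonempty habs,
      fun _ => Borsuk.encard_le_of_diam_lt_diam_Phi_image_M b⟩, by omega⟩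

theorem mainTheorem2 :
    ∃ (K : Set (EuclideanSpace ℝ (Fin 24))) (k l : Fin 24),
      K ⊆ Borsuk.M ∧ K.ncard = 143136 ∧ k < l ∧ (∀ x ∈ K, |x k| = |x l|) ∧
      (∀ b : OrthonormalBasis Borsuk.BasisIndex ℝ (EuclideanSpace ℝ (Fin 324)),
        (∃ S : AffineSubspace ℝ (EuclideanSpace ℝ (Fin 324)),
          Module.finrank ℝ S.direction = 322 ∧ Borsuk.Phi b '' K ⊆ S) ∧
        (∀ T : Set (EuclideanSpace ℝ (Fin 324)), T ⊆ Borsuk.Phi b '' Borsuk.M →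
          Metric.diam T < Metric.diam (Borsuk.Phi b '' Borsuk.M) → T.encard ≤ 350)) ∧
      ⌈(K.ncard : ℝ) / 350⌉₊ ≤ Borsuk.borsukNumber 322 ∧
      ⌈(K.ncard : ℝ) / 350⌉₊ = 409 := by
  obtain ⟨K, k, l, hKM, hcard, hkl, habs, hPhi, hborsuk⟩ := mainTheorem2_general
  have hceil : ⌈(K.ncard : ℝ) / 350⌉₊ = 409 := by
    rw [hcard, Nat.ceil_eq_iff (by norm_num)]
    norm_num
  exact ⟨K, k, l, hKM, hcard, hkl, habs, fun b => ⟨(hPhi b).1, fun T hT hdiam =>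
    ((hPhi b).2 T hT hdiam).trans (by norm_num)⟩, by omega, hceil⟩
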